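/- Let $(M,g)$ be an asymptotically flat 3-manifold: a smooth connected Riemannian 3-manifold, possibly with compact boundary, such that for some compact set $K\subset M$ and some closed ball $B\subset\mathbb{R}^3$ there is a diffeomorphism $M\setminus K\to\mathbb{R}^3\setminus B$ in whose coordinates $x$ one has $g_{ij}=\delta_{ij}+\sigma_{ij}$ with $\sigma_{ij}=O(|x|^{-\tau})$, $\partial_k\sigma_{ij}=O(|x|^{-\tau-1})$, $\partial_k\partial_\ell\sigma_{ij}=O(|x|^{-\tau-2})$ as $|x|\to\infty$, for some constant $\tau>\frac12$, and such that the scalar curvature of $g$ is integrable. For a compact set $K\subset M$ let $|K|$ be its Riemannian volume and let $$\mathrm{cap}(K)=\inf_{\psi}\frac{1}{4\pi}\int_M|\nabla\psi|_g^2\,dV_g$$ be its capacity, where the infimum is over all locally Lipschitz functions $\psi$ on $M$ that vanish on $K$ and tend uniformly to $1$ at infinity. Then $$\sup_{\{K_j\}}\limsup_{j\to\infty}\frac{1}{4\pi\,\mathrm{cap}(K_j)^2}\left[|K_j|-\frac{4\pi}{3}\mathrm{cap}(K_j)^3\right] =\sup_{\{K_j\}}\limsup_{j\to\infty}\left[\left(\frac{3|K_j|}{4\pi}\right)^{1/3}-\mathrm{cap}(K_j)\right]$$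 as extended real numbers, where both suprema are over all exhaustions $\{K_j\}_{j\ge 0}$ of $M$ by compact sets ($K_j\subset \operatorname{int}K_{j+1}$ and $\bigcup_j K_j=M$). (The left-hand side is the definition of the isocapacitary mass $m_{CV}(M,g)$.) -/

import Mathlib

open scoped Manifold ContDiff Topology ENNReal Bundle
open Filter MeasureTheory

noncomputable section

namespace AFMass

/-- The model vector space of a 3-manifold. -/
abbrev E3 : Type := EuclideanSpace ℝ (Fin 3)

/-- The model with corners of a smooth 3-manifold with (possibly empty) boundary. -/
abbrev I3 : ModelWithCorners ℝ E3 (EuclideanHalfSpace 3) := 𝓡∂ 3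

/-- The standard basis of `ℝ³`. -/
abbrev stdVec (i : Fin 3) : E3 := EuclideanSpace.single i (1 : ℝ)

/-! ### Coordinate expressions -/

/-- Partial derivative in the `i`-th coordinate direction, within a set `s` (an open subset of
`ℝ³` or of a half-space; at boundary points this is the one-sided derivative). -/
def pderiv (s : Set E3) (i : Fin 3) (f : E3 → ℝ) (y : E3) : ℝ :=
  fderivWithin ℝ f s y (stdVec i)

/-- Christoffel symbols `Γ^k_{ij}` of a matrix-valued function `G = (G_ij)` on `s`. -/
def christoffel (G : E3 → Matrix (Fin 3) (Fin 3) ℝ) (s : Set E3) (k i j : Fin 3) (y : E3) : ℝ :=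
  (1 / 2) * ∑ l, (G y)⁻¹ k l *
    (pderiv s i (fun z => G z j l) y + pderiv s j (fun z => G z i l) y
      - pderiv s l (fun z => G z i j) y)

/-- Components of the Ricci tensor of a matrix-valued function `G = (G_ij)` on `s`. -/
def ricci (G : E3 → Matrix (Fin 3) (Fin 3) ℝ) (s : Set E3) (i j : Fin 3) (y : E3) : ℝ :=
  ∑ k, (pderiv s k (christoffel G s k i j) y - pderiv s j (christoffel G s k i k) y)
    + ∑ k, ∑ l, (christoffel G s k k l y * christoffel G s l i j y
        - christoffel G s k j l y * christoffel G s l i k y)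

/-- Scalar curvature of a matrix-valued function `G = (G_ij)` on `s`. -/
def coordScalar (G : E3 → Matrix (Fin 3) (Fin 3) ℝ) (s : Set E3) (y : E3) : ℝ :=
  ∑ i, ∑ j, (G y)⁻¹ i j * ricci G s i j y

section Manifold

variable {M : Type*} [TopologicalSpace M] [ChartedSpace (EuclideanHalfSpace 3) M]
  [IsManifold I3 ∞ M]

variable (M) in
/-- Smooth Riemannian metrics on the 3-manifold with boundary `M`. -/
abbrev Metric3 : Type _ :=
  Bundle.ContMDiffRiemannianMetric I3 ∞ E3 (fun x : M => TangentSpace I3 x)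

/-- The components `g_ij = g(∂_i, ∂_j)` of `g` in the coordinates whose inverse
(parametrization) is `param : ℝ³ ⊇ s → M`. -/
def metricCoeff (g : Metric3 M) (param : E3 → M) (s : Set E3) (y : E3) :
    Matrix (Fin 3) (Fin 3) ℝ :=
  Matrix.of fun i j =>
    g.inner (param y) (mfderivWithin 𝓘(ℝ, E3) I3 param s y (stdVec i))
      (mfderivWithin 𝓘(ℝ, E3) I3 param s y (stdVec j))

/-- The components of `g` in the preferred chart around `p`. -/
def chartCoeff (g : Metric3 M) (p : M) : E3 → Matrix (Fin 3) (Fin 3) ℝ :=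
  metricCoeff g (extChartAt I3 p).symm (extChartAt I3 p).target

/-- The scalar curvature of `g` at `p`, computed in the preferred chart around `p`. -/
def scalarCurvature (g : Metric3 M) (p : M) : ℝ :=
  coordScalar (chartCoeff g p) (extChartAt I3 p).target (extChartAt I3 p p)

/-! ### Riemannian volume, Dirichlet energy and capacity -/

/-- The Riemannian volume of the domain of the preferred chart around `p`: the measure
`√(det g_ij) dy` in the coordinates `y`, transported to `M`. -/
def chartVolume [MeasurableSpace M] (g : Metric3 M) (p : M) : Measure M :=
  (((volume : Measure E3).restrict (extChartAt I3 p).target).withDensity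
    (fun y => ENNReal.ofReal (Real.sqrt (chartCoeff g p y).det))).map (extChartAt I3 p).symm

/-- The Riemannian volume measure `dV_g`. The measures `chartVolume g p` are the restrictions of
`dV_g` to the chart domains, so that `dV_g` is the least measure which dominates all of them
(`M` is covered by countably many chart domains). -/
def vol [MeasurableSpace M] (g : Metric3 M) : Measure M :=
  ⨆ p : M, chartVolume g p

/-- The differential `dψ` of a function `ψ` at `x`, a linear form on the tangent space. A locally
Lipschitz function is differentiable almost everywhere (at the remaining points the value is zero
by convention). -/
def differential (ψ : M → ℝ) (x : M) : TangentSpace I3 x →L[ℝ] ℝ :=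
  mfderiv I3 𝓘(ℝ, ℝ) ψ x

/-- `|∇ψ|_g²` at `x`, as the squared `g`-dual norm of the differential:
`|∇ψ|_g² = sup {dψ(v)² : g(v, v) ≤ 1}`. -/
def gradSq (g : Metric3 M) (ψ : M → ℝ) (x : M) : ℝ≥0∞ :=
  ⨆ (v : TangentSpace I3 x) (_ : g.inner x v v ≤ 1),
    ENNReal.ofReal ((differential ψ x v) ^ 2)

/-- Locally Lipschitz functions on `M`: locally Lipschitz in charts. -/
def LocLipschitz (ψ : M → ℝ) : Prop :=
  ∀ p : M, LocallyLipschitzOn (extChartAt I3 p).target (ψ ∘ (extChartAt I3 p).symm)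

/-- Admissible functions for the capacity of `K`: locally Lipschitz functions on `M` which vanish
on `K` and tend uniformly to `1` at infinity. -/
structure IsAdmissible (K : Set M) (ψ : M → ℝ) : Prop where
  locLipschitz : LocLipschitz ψ
  eq_zero : ∀ x ∈ K, ψ x = 0
  tendsto_one : Tendsto ψ (cocompact M) (𝓝 1)

/-- The capacity `inf_ψ (1/4π) ∫_M |∇ψ|_g² dV_g` of `K`, as an extended nonnegative number. -/
def ecapacity [MeasurableSpace M] (g : Metric3 M) (K : Set M) : ℝ≥0∞ :=
  ⨅ (ψ : M → ℝ) (_ : IsAdmissible K ψ),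
    ENNReal.ofReal (1 / (4 * Real.pi)) * ∫⁻ x, gradSq g ψ x ∂(vol g)

/-- The capacity of `K` (finite for compact `K`) as a real number. -/
def capacity [MeasurableSpace M] (g : Metric3 M) (K : Set M) : ℝ :=
  (ecapacity g K).toReal

/-- The volume `|K|` of `K` (finite for compact `K`) as a real number. -/
def volumeOf [MeasurableSpace M] (g : Metric3 M) (K : Set M) : ℝ :=
  (vol g).real K

/-- The volume radius `(3|K| / 4π)^{1/3}` of `K`. -/
def volumeRadius [MeasurableSpace M] (g : Metric3 M) (K : Set M) : ℝ :=
  (3 * volumeOf g K / (4 * Real.pi)) ^ (1 / 3 : ℝ)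

/-! ### Asymptotically flat 3-manifolds -/

/-- `Φ` is an asymptotically flat coordinate system of order `τ` for `g`: a diffeomorphism from
the complement of a compact set onto the complement of a closed ball in `ℝ³`, in which
`σ_ij = g_ij - δ_ij` and its first and second partial derivatives decay like
`|x|^{-τ}`, `|x|^{-τ-1}`, `|x|^{-τ-2}` as `|x| → ∞`. -/
structure IsAFChart (g : Metric3 M) (Φ : OpenPartialHomeomorph M E3) (τ : ℝ) : Prop where
  isCompact_compl : IsCompact Φ.sourceᶜ
  target_eq : ∃ (c : E3) (R : ℝ), 0 < R ∧ Φ.target = (Metric.closedBall c R)ᶜ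
  contMDiffOn : ContMDiffOn I3 𝓘(ℝ, E3) ∞ Φ Φ.source
  contMDiffOn_symm : ContMDiffOn 𝓘(ℝ, E3) I3 ∞ Φ.symm Φ.target
  decay : ∀ i j : Fin 3,
    (fun x => metricCoeff g Φ.symm Φ.target x i j - (1 : Matrix (Fin 3) (Fin 3) ℝ) i j)
      =O[Bornology.cobounded E3] fun x => ‖x‖ ^ (-τ)
  decay_deriv : ∀ i j k : Fin 3,
    pderiv Φ.target k
      (fun x => metricCoeff g Φ.symm Φ.target x i j - (1 : Matrix (Fin 3) (Fin 3) ℝ) i j)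
      =O[Bornology.cobounded E3] fun x => ‖x‖ ^ (-τ - 1)
  decay_deriv₂ : ∀ i j k l : Fin 3,
    pderiv Φ.target k (pderiv Φ.target l
      (fun x => metricCoeff g Φ.symm Φ.target x i j - (1 : Matrix (Fin 3) (Fin 3) ℝ) i j))
      =O[Bornology.cobounded E3] fun x => ‖x‖ ^ (-τ - 2)

/-- `(M, g)` is an asymptotically flat 3-manifold: a connected Riemannian 3-manifold, possibly
with compact boundary, which has an asymptotically flat coordinate system of some order
`τ > 1/2` and integrable scalar curvature. -/
structure IsAsymptoticallyFlat [MeasurableSpace M] (g : Metric3 M) : Prop where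
  connected : ConnectedSpace M
  isCompact_boundary : IsCompact (I3.boundary M)
  exists_chart : ∃ (Φ : OpenPartialHomeomorph M E3) (τ : ℝ), 1 / 2 < τ ∧ IsAFChart g Φ τ
  integrable_scalar : Integrable (scalarCurvature g) (vol g)

/-! ### The isocapacitary mass -/

/-- The isocapacitary (capacity-volume) mass, an extended real number: the supremum over all
exhaustions by compact sets `K_j` of
`limsup_j (|K_j| - (4π/3) cap(K_j)³) / (4π cap(K_j)²)`. -/
def isocapacitaryMass [MeasurableSpace M] (g : Metric3 M) : EReal :=
  ⨆ K : CompactExhaustion M, limsup (fun j : ℕ =>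
    ((1 / (4 * Real.pi * capacity g (K j) ^ 2) *
      (volumeOf g (K j) - 4 * Real.pi / 3 * capacity g (K j) ^ 3) : ℝ) : EReal)) atTop

end Manifold

end AFMass

end

open scoped Manifold ContDiff Topology ENNReal Bundle
open Filter MeasureTheory

noncomputable section

namespace AFMass

/-! ### Comparison of the two limits superior -/

/-! The equality already holds for each exhaustion separately. Write `r` for the volume radius of a
compact set, `c` for its capacity and `d = r - c`. Since the volume is `4π/3 * r³`, the quantity on
the left is `(r³ - c³) / (3c²) = d + d²/c + d³/(3c²)`. It is at least `d`, because `(r - c)² (r +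
2c) ≥ 0`; and if `d < b` it is at most `b + b²/c + b³/(3c²)`, which tends to `b` when `c → ∞`. So
`limsup_deficit_eq` reduces the theorem to the divergence of the capacities along every exhaustion,
`tendsto_capacity_atTop`.

For the divergence, an exhaustion eventually contains any given coordinate sphere of radius `R`. An
admissible function vanishes there and exceeds `1/2` far out, so along each radial line its weighted
energy is at least `R/4`; polar coordinates turn this into a Euclidean bound linear in `R`
(`le_lintegral_sq_radial_fderiv`). Near infinity the metric is comparable to the Euclidean one, so
the bound passes to `M` (`exists_le_ecapacity`). This requires that `vol`, a supremum over preferred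
charts, can be computed in the asymptotically flat chart, and that infinity in that chart is
infinity in `M` (`exists_forall_symm_notMem`). Finally `ecapacity_lt_top` is needed because `toReal`
sends `⊤` to `0`. -/

/-- If the capacities `c j` tend to infinity, the limits superior of the two notions of
volume-capacity deficit agree, for volumes `v j ≥ 0`. -/
theorem limsup_deficit_eq {v c : ℕ → ℝ} (hv : ∀ j, 0 ≤ v j) (hc : Tendsto c atTop atTop) :
    limsup (fun j => ((1 / (4 * Real.pi * c j ^ 2) *
      (v j - 4 * Real.pi / 3 * c j ^ 3) : ℝ) : EReal)) atTop =
    limsup (fun j => (((3 * v j / (4 * Real.pi)) ^ (1 / 3 : ℝ) - c j : ℝ) : EReal)) atTop := by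
  set r : ℕ → ℝ := fun j => (3 * v j / (4 * Real.pi)) ^ (1 / 3 : ℝ) with hr
  have hπ := Real.pi_pos
  have hr0 : ∀ j, 0 ≤ r j := fun j => Real.rpow_nonneg (by have := hv j; positivity) _
  have hr3 : ∀ j, v j = 4 * Real.pi / 3 * r j ^ 3 := by
    intro j
    have h0 : 0 ≤ 3 * v j / (4 * Real.pi) := by have := hv j; positivity
    have : r j ^ 3 = 3 * v j / (4 * Real.pi) := by
      rw [hr, ← Real.rpow_natCast, ← Real.rpow_mul h0]; norm_num
    rw [this]; field_simp
  have hf : ∀ j, 0 < c j → 1 / (4 * Real.pi * c j ^ 2) * (v j - 4 * Real.pi / 3 * c j ^ 3) =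
      (r j ^ 3 - c j ^ 3) / (3 * c j ^ 2) := by
    intro j hj
    rw [hr3 j]; field_simp
  have hpos : ∀ᶠ j in atTop, 0 < c j := hc.eventually_gt_atTop 0
  apply le_antisymm
  · refine EReal.le_of_forall_lt_iff_le.1 fun a ha => ?_
    obtain ⟨b, hb, hba⟩ := EReal.lt_iff_exists_real_btwn.1 ha
    have hba : b < a := by exact_mod_cast hba
    have hev := eventually_lt_of_limsup_lt hb
    -- This is `((b + c)³ - c³) / (3c²)`, the value of the deficit at `r = b + c`; cubing is
    -- monotone, so `b` may be negative.
    have hlim : Tendsto (fun j => b + b ^ 2 * (c j)⁻¹ + b ^ 3 / 3 * ((c j)⁻¹) ^ 2) atTop (𝓝 b) := by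
      have h := tendsto_inv_atTop_zero.comp hc
      have := ((h.const_mul (b ^ 2)).const_add b).add ((h.pow 2).const_mul (b ^ 3 / 3))
      simpa using this
    refine limsup_le_of_le (by isBoundedDefault) ?_
    filter_upwards [hev, hpos, hlim.eventually_lt_const hba] with j h1 h2 h3
    have h1 : r j - c j < b := by exact_mod_cast h1
    rw [hf j h2]
    have : (r j ^ 3 - c j ^ 3) / (3 * c j ^ 2) ≤ a := by
      refine le_trans ?_ h3.le
      have e : b + b ^ 2 * (c j)⁻¹ + b ^ 3 / 3 * ((c j)⁻¹) ^ 2 =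
          ((b + c j) ^ 3 - c j ^ 3) / (3 * c j ^ 2) := by field_simp; ring
      rw [e]
      have : r j ^ 3 ≤ (b + c j) ^ 3 := pow_le_pow_left₀ (hr0 j) (by linarith) 3
      gcongr
    exact_mod_cast this
  · refine limsup_le_limsup ?_ (by isBoundedDefault) (by isBoundedDefault)
    filter_upwards [hpos] with j h2
    rw [hf j h2]
    -- The difference of the two sides, times `3c²`, is `(r - c)² (r + 2c)`.
    have : r j - c j ≤ (r j ^ 3 - c j ^ 3) / (3 * c j ^ 2) := by
      rw [le_div_iff₀ (by positivity)]
      nlinarith [mul_nonneg (sq_nonneg (r j - c j)) (by linarith [hr0 j] : 0 ≤ r j + 2 * c j)]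
    exact_mod_cast this

/-! ### A lower bound for the Dirichlet energy outside a ball -/

/-- The weighted one-dimensional energy of a function which grows from `0` to at least `1 / 2`
on `[R, S]`. -/
theorem le_lintegral_sq_deriv_mul_sq {h : ℝ → ℝ} {R S : ℝ} (hR : 0 < R) (hRS : R ≤ S)
    (hh : LocallyLipschitzOn (Set.Icc R S) h) (h0 : h R = 0) (h1 : 1 / 2 ≤ h S) :
    ENNReal.ofReal (R / 4) ≤
      ∫⁻ r in Set.Ioc R S, ENNReal.ofReal (deriv h r ^ 2) * ENNReal.ofReal (r ^ 2) := by
  obtain ⟨K, hK⟩ := hh.exists_lipschitzOnWith_of_compact isCompact_Icc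
  have hac : AbsolutelyContinuousOnInterval h R S :=
    LipschitzOnWith.absolutelyContinuousOnInterval (K := K) (by rwa [Set.uIcc_of_le hRS])
  have hint := hac.intervalIntegrable_deriv
  have hinv : IntervalIntegrable (fun r : ℝ => (r ^ 2)⁻¹) volume R S := by
    apply ContinuousOn.intervalIntegrable
    rw [Set.uIcc_of_le hRS]
    exact (continuousOn_id.pow 2).inv₀ fun x hx => by have := hR.trans_le hx.1; exact (pow_pos this 2).ne'
  have hinvI : ∫ r in R..S, (r ^ 2)⁻¹ = R⁻¹ - S⁻¹ := by
    have := integral_zpow (a := R) (b := S) (n := -2) (Or.inr ⟨by norm_num, by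
      rw [Set.uIcc_of_le hRS]; rintro ⟨h, _⟩; linarith⟩)
    norm_num [zpow_neg] at this
    rw [this]
    ring
  -- Completing the square against `R / (2r)` gives `(r h')² ≥ R h' - R² / (4r²)`. The comparison
  -- value `R / (2r)` is `r h'` for the harmonic profile `h = (1 - R/r) / 2`. The right side
  -- integrates to at least `R/2 - R/4`.
  have hFI : IntervalIntegrable (fun r => R * deriv h r - R ^ 2 / 4 * (r ^ 2)⁻¹) volume R S :=
    (hint.const_mul R).sub (hinv.const_mul _)
  have hval : R / 4 ≤ ∫ r in R..S, (R * deriv h r - R ^ 2 / 4 * (r ^ 2)⁻¹) := by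
    rw [intervalIntegral.integral_sub (hint.const_mul R) (hinv.const_mul _),
      intervalIntegral.integral_const_mul, intervalIntegral.integral_const_mul,
      hac.integral_deriv_eq_sub, hinvI, h0]
    have hS : 0 < S := by linarith
    have e : R ^ 2 / 4 * (R⁻¹ - S⁻¹) ≤ R / 4 := by
      have : R ^ 2 / 4 * R⁻¹ = R / 4 := by field_simp
      have : 0 ≤ R ^ 2 / 4 * S⁻¹ := by positivity
      linarith
    nlinarith
  rw [intervalIntegral.integral_of_le hRS] at hval
  calc ENNReal.ofReal (R / 4)
      ≤ ENNReal.ofReal (∫ r in Set.Ioc R S, (R * deriv h r - R ^ 2 / 4 * (r ^ 2)⁻¹)) :=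
        ENNReal.ofReal_le_ofReal hval
    _ ≤ ∫⁻ r in Set.Ioc R S, ENNReal.ofReal (R * deriv h r - R ^ 2 / 4 * (r ^ 2)⁻¹) :=
        by
        -- The integrand may be negative, and `ENNReal.ofReal` truncates it, so the integral is
        -- first bounded by that of the positive part.
        have hi := (intervalIntegrable_iff_integrableOn_Ioc_of_le hRS).1 hFI
        refine (ENNReal.ofReal_le_ofReal (integral_mono hi hi.pos_part
          fun r => le_max_left _ _)).trans_eq ?_
        rw [ofReal_integral_eq_lintegral_ofReal hi.pos_part (ae_of_all _ fun r => le_max_right _ _)]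
        simp
    _ ≤ _ := by
        refine setLIntegral_mono' measurableSet_Ioc fun r hr => ?_
        rw [← ENNReal.ofReal_mul (sq_nonneg _)]
        apply ENNReal.ofReal_le_ofReal
        have hr0 : 0 < r := hR.trans hr.1
        have h2 : R * deriv h r = 2 * (deriv h r * r) * (R / 2 * r⁻¹) := by field_simp
        have h3 : R ^ 2 / 4 * (r ^ 2)⁻¹ = (R / 2 * r⁻¹) ^ 2 := by field_simp; norm_num
        rw [h2, h3]
        nlinarith [sq_nonneg (deriv h r * r - R / 2 * r⁻¹)]

/-- Rademacher's theorem for locally Lipschitz functions on an open set. -/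
theorem ae_differentiableAt_of_locallyLipschitzOn {u : E3 → ℝ} {U : Set E3} (hU : IsOpen U)
    (hu : LocallyLipschitzOn U u) : ∀ᵐ x, x ∈ U → DifferentiableAt ℝ u x := by
  have : volume {x | ¬ (x ∈ U → DifferentiableAt ℝ u x)} = 0 := by
    refine measure_null_of_locally_null _ fun x hx => ?_
    simp only [Classical.not_imp, Set.mem_ofPred_eq] at hx
    obtain ⟨K, t, ht, hK⟩ := hu hx.1
    rw [hU.nhdsWithin_eq hx.1] at ht
    refine ⟨_, inter_mem_nhdsWithin _ (interior_mem_nhds.2 ht), ?_⟩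
    have h := (hK.mono interior_subset).ae_differentiableWithinAt_of_mem (μ := volume)
    refine measure_mono_null ?_ h
    rintro y ⟨hy, hyt⟩ hd
    simp only [Classical.not_imp, Set.mem_ofPred_eq] at hy
    exact hy.2 ((hd hyt).differentiableAt (isOpen_interior.mem_nhds hyt))
  exact this

/-- Polar coordinates on `ℝ³`. -/
theorem measurePreserving_smul_sphere :
    MeasurePreserving (fun p : Metric.sphere (0 : E3) 1 × Set.Ioi (0 : ℝ) => (p.2 : ℝ) • (p.1 : E3))
      ((volume : Measure E3).toSphere.prod (Measure.volumeIoiPow 2))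
      (volume : Measure E3) := by
  have h1 := (volume : Measure E3).measurePreserving_homeomorphUnitSphereProd
  have h2 := MeasurePreserving.symm (homeomorphUnitSphereProd E3).toMeasurableEquiv h1
  have h3 := (measurePreserving_subtype_coe (μa := (volume : Measure E3))
    (measurableSet_singleton (0 : E3)).compl).comp h2
  rw [restrict_compl_singleton] at h3
  have hd : Module.finrank ℝ E3 - 1 = 2 := by simp
  rw [hd] at h3
  exact h3

/-- The Dirichlet energy of a function which vanishes on the sphere of radius `R` and is at least
`1 / 2` far out is bounded below by a multiple of `R`. -/
theorem le_lintegral_sq_radial_fderiv {u : E3 → ℝ} {R₀ R S : ℝ} (hR₀ : 0 < R₀) (hR : R₀ < R)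
    (hu : LocallyLipschitzOn {x : E3 | R₀ < ‖x‖} u) (h0 : ∀ x, ‖x‖ = R → u x = 0)
    (h1 : ∀ x, S ≤ ‖x‖ → 1 / 2 ≤ u x) :
    ENNReal.ofReal (R / 4) * (volume : Measure E3).toSphere Set.univ ≤
      ∫⁻ x in {x : E3 | R < ‖x‖}, ENNReal.ofReal (fderiv ℝ u x (‖x‖⁻¹ • x) ^ 2) := by
  wlog hRS : R ≤ S generalizing S
  · exact this (S := max R S) (fun x hx => h1 x ((le_max_right _ _).trans hx)) (le_max_left _ _)
  have hRpos := hR₀.trans hR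
  have hU : MeasurableSet {x : E3 | R < ‖x‖} := measurableSet_lt measurable_const measurable_norm
  set F : E3 → ℝ≥0∞ := fun x => ENNReal.ofReal (fderiv ℝ u x (‖x‖⁻¹ • x) ^ 2) with hF
  have hFm : Measurable F := by
    have h2 : Measurable fun x : E3 => fderiv ℝ u x (‖x‖⁻¹ • x) := by
      have h3 : Measurable fun x : E3 => (fderiv ℝ u x, ‖x‖⁻¹ • x) :=
        (measurable_fderiv ℝ u).prodMk (by fun_prop)
      have h4 : Continuous fun p : (E3 →L[ℝ] ℝ) × E3 => p.1 p.2 := by fun_prop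
      exact h4.measurable.comp h3
    exact (h2.pow_const 2).ennreal_ofReal
  have hpolar := measurePreserving_smul_sphere
  have hopen : IsOpen {x : E3 | R₀ < ‖x‖} := isOpen_lt continuous_const continuous_norm
  -- By Fubini, on almost every ray `u` is differentiable at almost every point, which lets the
  -- chain rule identify `deriv h` with the radial part of `fderiv ℝ u`.
  have hae := Measure.ae_ae_of_ae_prod
    (hpolar.quasiMeasurePreserving.ae (ae_differentiableAt_of_locallyLipschitzOn hopen hu))
  rw [← lintegral_indicator hU, ← hpolar.lintegral_comp (hFm.indicator hU),
    lintegral_prod (fun p : Metric.sphere (0 : E3) 1 × Set.Ioi (0 : ℝ) =>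
      {x : E3 | R < ‖x‖}.indicator F ((p.2 : ℝ) • (p.1 : E3)))
      ((hFm.indicator hU).comp hpolar.measurable).aemeasurable,
    ← lintegral_const]
  refine lintegral_mono_ae ?_
  filter_upwards [hae] with θ hθ
  have hθ1 : ‖(θ : E3)‖ = 1 := by simp
  have hnorm : ∀ r : ℝ, 0 < r → ‖r • (θ : E3)‖ = r := fun r hr => by
    rw [norm_smul, hθ1, mul_one, Real.norm_of_nonneg hr.le]
  set h : ℝ → ℝ := fun r => u (r • (θ : E3)) with hh
  have hline : LipschitzWith 1 (fun r : ℝ => r • (θ : E3)) :=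
    LipschitzWith.of_dist_le_mul fun a b => by
      rw [dist_eq_norm, ← sub_smul, norm_smul, hθ1, dist_eq_norm]; simp
  have hlip : LocallyLipschitzOn (Set.Icc R S) h := by
    intro r hr
    have hr0 : 0 < r := hRpos.trans_le hr.1
    obtain ⟨K, t, ht, hK⟩ := hu (x := r • (θ : E3)) (by
      simp only [Set.mem_ofPred_eq, hnorm r hr0]; exact hR.trans_le hr.1)
    rw [hopen.nhdsWithin_eq (by
      simp only [Set.mem_ofPred_eq, hnorm r hr0]; exact hR.trans_le hr.1)] at ht
    exact ⟨K * 1, _, mem_nhdsWithin_of_mem_nhds (hline.continuous.continuousAt.preimage_mem_nhds ht),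
      hK.comp hline.lipschitzOnWith (Set.mapsTo_preimage _ _)⟩
  have key := le_lintegral_sq_deriv_mul_sq hRpos hRS hlip (h0 _ (hnorm R hRpos))
    (h1 _ (hnorm S (hRpos.trans_le hRS)).ge)
  refine key.trans ?_
  set G : ℝ → ℝ≥0∞ := (Set.Ioc R S).indicator fun r => ENNReal.ofReal (deriv h r ^ 2) with hG
  have hGm : Measurable G :=
    (((measurable_deriv h).pow_const 2).ennreal_ofReal).indicator measurableSet_Ioc
  have hle : ∫⁻ r : Set.Ioi (0 : ℝ), G r ∂(Measure.volumeIoiPow 2) ≤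
      ∫⁻ r : Set.Ioi (0 : ℝ), ({x : E3 | R < ‖x‖}.indicator F) ((r : ℝ) • (θ : E3))
        ∂(Measure.volumeIoiPow 2) := by
    refine lintegral_mono_ae ?_
    filter_upwards [hθ] with r hr
    have hr0 : 0 < (r : ℝ) := r.2
    by_cases hrI : (r : ℝ) ∈ Set.Ioc R S
    · have hn := hnorm r hr0
      rw [hG, Set.indicator_of_mem hrI, Set.indicator_of_mem (by simp [hn, hrI.1])]
      have hd := hr (by simp only [hn]; exact hR.trans hrI.1)
      have hder : HasDerivAt h (fderiv ℝ u ((r : ℝ) • (θ : E3)) θ) r :=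
        hd.hasFDerivAt.comp_hasDerivAt (r : ℝ) (by
          simpa using (hasDerivAt_id (r : ℝ)).smul_const (θ : E3))
      rw [hder.deriv, hF]
      simp only [hn, smul_smul, inv_mul_cancel₀ hr0.ne', one_smul, le_refl]
    · rw [hG, Set.indicator_of_notMem hrI]; exact zero_le
  refine le_trans ?_ hle
  rw [Measure.volumeIoiPow, lintegral_withDensity_eq_lintegral_mul _
    (by fun_prop) (g := fun r : Set.Ioi (0 : ℝ) => G r) (hGm.comp measurable_subtype_coe)]
  simp only [Pi.mul_apply]
  rw [lintegral_subtype_comap measurableSet_Ioi (fun r : ℝ => ENNReal.ofReal (r ^ 2) * G r)]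
  rw [← lintegral_indicator measurableSet_Ioc, ← lintegral_indicator measurableSet_Ioi]
  refine lintegral_mono fun r => ?_
  by_cases hrI : r ∈ Set.Ioc R S
  · rw [Set.indicator_of_mem hrI, Set.indicator_of_mem (Set.mem_Ioi.2 (hRpos.trans hrI.1)), hG,
      Set.indicator_of_mem hrI, mul_comm]
  · rw [Set.indicator_of_notMem hrI]; exact zero_le

section Parametrization

variable {M : Type*} [TopologicalSpace M] [ChartedSpace (EuclideanHalfSpace 3) M]

/-! ### Smooth coordinate systems -/

/-- A smooth coordinate system on an open subset of `M`. -/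
structure IsCoordinates (e : PartialEquiv M E3) : Prop where
  isOpen_source : IsOpen e.source
  measurableSet_target : MeasurableSet e.target
  uniqueDiffOn_target : UniqueDiffOn ℝ e.target
  contMDiffOn : ContMDiffOn I3 𝓘(ℝ, E3) 1 e e.source
  contMDiffOn_symm : ContMDiffOn 𝓘(ℝ, E3) I3 1 e.symm e.target

/-- The differential of a coordinate map, as an endomorphism of the model space. -/
def coordDeriv (e : PartialEquiv M E3) (x : M) : E3 →L[ℝ] E3 :=
  mfderiv I3 𝓘(ℝ, E3) e x

/-- The differential of the inverse of a coordinate map, as an endomorphism of the model space. -/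
def coordSymmDeriv (e : PartialEquiv M E3) (y : E3) : E3 →L[ℝ] E3 :=
  mfderivWithin 𝓘(ℝ, E3) I3 e.symm e.target y

theorem IsCoordinates.hasMFDerivAt {e : PartialEquiv M E3} (he : IsCoordinates e) {x : M}
    (hx : x ∈ e.source) : HasMFDerivAt I3 𝓘(ℝ, E3) e x (coordDeriv e x) :=
  ((he.contMDiffOn.contMDiffAt (he.isOpen_source.mem_nhds hx)).mdifferentiableAt
    one_ne_zero).hasMFDerivAt

theorem IsCoordinates.hasMFDerivWithinAt_symm {e : PartialEquiv M E3} (he : IsCoordinates e)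
    {y : E3} (hy : y ∈ e.target) :
    HasMFDerivWithinAt 𝓘(ℝ, E3) I3 e.symm e.target y (coordSymmDeriv e y) :=
  ((he.contMDiffOn_symm y hy).mdifferentiableWithinAt one_ne_zero).hasMFDerivWithinAt

/-- Chain rule for `e.symm ∘ e = id`; derivatives within the open source are unique, also at
boundary points of `M`. -/
theorem IsCoordinates.coordSymmDeriv_comp {e : PartialEquiv M E3} (he : IsCoordinates e)
    {x : M} (hx : x ∈ e.source) :
    (coordSymmDeriv e (e x)).comp (coordDeriv e x) = ContinuousLinearMap.id ℝ E3 := by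
  have h1 := (he.hasMFDerivWithinAt_symm (e.map_source hx)).comp x
    (he.hasMFDerivAt hx).hasMFDerivWithinAt e.mapsTo
  have h2 : HasMFDerivWithinAt I3 I3 (e.symm ∘ e) e.source x (ContinuousLinearMap.id ℝ E3) :=
    (hasMFDerivWithinAt_id e.source x).congr_mono (fun y hy => e.left_inv hy) (e.left_inv hx)
      subset_rfl
  exact (he.isOpen_source.uniqueMDiffWithinAt hx).eq h1 h2

/-- In finite dimension a one-sided inverse of an endomorphism is two-sided. -/
theorem IsCoordinates.coordDeriv_comp {e : PartialEquiv M E3} (he : IsCoordinates e)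
    {x : M} (hx : x ∈ e.source) :
    (coordDeriv e x).comp (coordSymmDeriv e (e x)) = ContinuousLinearMap.id ℝ E3 := by
  have h := he.coordSymmDeriv_comp hx
  ext1 v
  have hs : Function.Injective (coordSymmDeriv e (e x)) := by
    have : Function.Surjective (coordSymmDeriv e (e x)) := fun w =>
      ⟨coordDeriv e x w, by simpa using congrArg (fun L => L w) h⟩
    exact LinearMap.injective_iff_surjective (f := (coordSymmDeriv e (e x)).toLinearMap).2 this
  apply hs
  exact congrArg (fun L => L (coordSymmDeriv e (e x) v)) h

/-- The differential of the change of coordinates from `e` to `e'` at `y`. -/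
def transitionDeriv (e e' : PartialEquiv M E3) (y : E3) : E3 →L[ℝ] E3 :=
  (coordDeriv e' (e.symm y)).comp (coordSymmDeriv e y)

theorem IsCoordinates.hasFDerivWithinAt_transition {e e' : PartialEquiv M E3}
    (he : IsCoordinates e) (he' : IsCoordinates e') {y : E3} (hy : y ∈ e.target)
    (hy' : e.symm y ∈ e'.source) :
    HasFDerivWithinAt (e' ∘ e.symm) (transitionDeriv e e' y) e.target y :=
  ((he'.hasMFDerivAt hy').comp_hasMFDerivWithinAt y
    (he.hasMFDerivWithinAt_symm hy)).hasFDerivWithinAt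

theorem IsCoordinates.coordSymmDeriv_comp_transitionDeriv {e e' : PartialEquiv M E3}
    (he' : IsCoordinates e') {y : E3} (hy' : e.symm y ∈ e'.source) :
    (coordSymmDeriv e' (e' (e.symm y))).comp (transitionDeriv e e' y) = coordSymmDeriv e y := by
  rw [transitionDeriv, ← ContinuousLinearMap.comp_assoc, he'.coordSymmDeriv_comp hy',
    ContinuousLinearMap.id_comp]

theorem IsCoordinates.measurableSet_target_inter_preimage [MeasurableSpace M] [BorelSpace M]
    {e : PartialEquiv M E3} (he : IsCoordinates e) {A : Set M} (hA : MeasurableSet A) :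
    MeasurableSet (e.target ∩ e.symm ⁻¹' A) := by
  have hc := continuousOn_iff_continuous_domRestrict.1 he.contMDiffOn_symm.continuousOn
  have := he.measurableSet_target.subtype_image (hc.measurable hA)
  convert this using 1
  ext y
  simp [and_comm]

variable [IsManifold I3 ∞ M]

theorem isCoordinates_extChartAt (p : M) : IsCoordinates (extChartAt I3 p) where
  isOpen_source := isOpen_extChartAt_source p
  measurableSet_target := by
    rw [extChartAt_target]
    exact ((chartAt _ p).open_target.preimage I3.continuous_symm).measurableSet.inter
      I3.isClosed_range.measurableSet
  uniqueDiffOn_target := uniqueDiffOn_extChartAt_target p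
  contMDiffOn := by
    have : IsManifold I3 1 M := IsManifold.of_le (n := ∞) (by simp)
    rw [extChartAt_source]
    exact contMDiffOn_extChartAt
  contMDiffOn_symm := by
    have : IsManifold I3 1 M := IsManifold.of_le (n := ∞) (by simp)
    exact contMDiffOn_extChartAt_symm p

theorem IsAFChart.isCoordinates {g : Metric3 M} {Φ : OpenPartialHomeomorph M E3} {τ : ℝ}
    (h : IsAFChart g Φ τ) : IsCoordinates Φ.toPartialEquiv where
  isOpen_source := Φ.open_source
  measurableSet_target := Φ.open_target.measurableSet
  uniqueDiffOn_target := Φ.open_target.uniqueDiffOn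
  contMDiffOn := h.contMDiffOn.of_le (by simp)
  contMDiffOn_symm := h.contMDiffOn_symm.of_le (by simp)

/-- The metric at `p` as a bilinear form on the model space. -/
def metricForm (g : Metric3 M) (p : M) : E3 →L[ℝ] E3 →L[ℝ] ℝ := g.inner p

theorem metricCoeff_apply (g : Metric3 M) (e : PartialEquiv M E3) (y : E3) (i j : Fin 3) :
    metricCoeff g e.symm e.target y i j =
      metricForm g (e.symm y) (coordSymmDeriv e y (stdVec i)) (coordSymmDeriv e y (stdVec j)) :=
  rfl

/-- The standard basis of `E3`, as a basis. -/
abbrev stdBasis : Module.Basis (Fin 3) ℝ E3 := (EuclideanSpace.basisFun (Fin 3) ℝ).toBasis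

/-- The metric in the coordinates `e`, as a bilinear form. -/
def coordForm (g : Metric3 M) (e : PartialEquiv M E3) (y : E3) : LinearMap.BilinForm ℝ E3 :=
  LinearMap.mk₂ ℝ
    (fun v w => metricForm g (e.symm y) (coordSymmDeriv e y v) (coordSymmDeriv e y w))
    (by simp) (by simp) (by simp) (by simp)

theorem metricCoeff_eq_toMatrix (g : Metric3 M) (e : PartialEquiv M E3) (y : E3) :
    metricCoeff g e.symm e.target y =
      LinearMap.BilinForm.toMatrix stdBasis (coordForm g e y) := by
  ext i j
  rw [LinearMap.BilinForm.toMatrix_apply, metricCoeff_apply]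
  simp [coordForm]

/-- A change of basis acts on a Gram matrix by congruence, hence the squared Jacobian. -/
theorem det_metricCoeff_transition (g : Metric3 M) {e e' : PartialEquiv M E3}
    (he' : IsCoordinates e') {y : E3} (hy' : e.symm y ∈ e'.source) :
    (metricCoeff g e.symm e.target y).det =
      (transitionDeriv e e' y).det ^ 2 *
        (metricCoeff g e'.symm e'.target (e' (e.symm y))).det := by
  have h : coordForm g e y = (coordForm g e' (e' (e.symm y))).comp
      (transitionDeriv e e' y).toLinearMap (transitionDeriv e e' y).toLinearMap := by
    ext v w
    have hc := fun u => congrArg (fun L => L u)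
      (he'.coordSymmDeriv_comp_transitionDeriv (e := e) hy')
    simp only [ContinuousLinearMap.comp_apply] at hc
    simp [coordForm, hc, e'.left_inv hy']
  rw [metricCoeff_eq_toMatrix, metricCoeff_eq_toMatrix, h,
    LinearMap.BilinForm.toMatrix_comp stdBasis stdBasis, Matrix.det_mul, Matrix.det_mul,
    Matrix.det_transpose, LinearMap.det_toMatrix, ContinuousLinearMap.det]
  ring

/-! ### The Riemannian measure in coordinates -/

/-- The Riemannian volume in the coordinates `e`, transported to `M`. -/
def coordVolume [MeasurableSpace M] (g : Metric3 M) (e : PartialEquiv M E3) : Measure M :=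
  (((volume : Measure E3).restrict e.target).withDensity
    (fun y => ENNReal.ofReal (Real.sqrt (metricCoeff g e.symm e.target y).det))).map e.symm

theorem coordVolume_apply [MeasurableSpace M] [BorelSpace M] (g : Metric3 M) {e : PartialEquiv M E3}
    (he : IsCoordinates e) {A : Set M} (hA : MeasurableSet A) :
    coordVolume g e A = ∫⁻ y in e.target ∩ e.symm ⁻¹' A,
      ENNReal.ofReal (Real.sqrt (metricCoeff g e.symm e.target y).det) := by
  have hm : AEMeasurable e.symm ((volume : Measure E3).restrict e.target) := by
    rw [aemeasurable_restrict_iff_comap_subtype he.measurableSet_target]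
    exact (continuousOn_iff_continuous_domRestrict.1
      he.contMDiffOn_symm.continuousOn).measurable.aemeasurable
  rw [coordVolume, Measure.map_apply_of_aemeasurable
    (hm.mono_ac (withDensity_absolutelyContinuous _ _)) hA, withDensity_apply',
    Measure.restrict_restrict' he.measurableSet_target, Set.inter_comm]

/-- The Jacobian from the change of variables formula is exactly the factor by which `√det` changes
between the two coordinate systems. -/
theorem coordVolume_eq_of_subset [MeasurableSpace M] [BorelSpace M] (g : Metric3 M) {e e' : PartialEquiv M E3}
    (he : IsCoordinates e) (he' : IsCoordinates e') {A : Set M} (hA : MeasurableSet A)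
    (hAe : A ⊆ e.source) (hAe' : A ⊆ e'.source) :
    coordVolume g e A = coordVolume g e' A := by
  rw [coordVolume_apply g he hA, coordVolume_apply g he' hA]
  have himg : e'.target ∩ e'.symm ⁻¹' A = (e' ∘ e.symm) '' (e.target ∩ e.symm ⁻¹' A) := by
    ext z
    constructor
    · rintro ⟨hz, hzA⟩
      refine ⟨e (e'.symm z), ⟨e.map_source (hAe hzA), ?_⟩, ?_⟩
      · simpa [e.left_inv (hAe hzA)] using hzA
      · simp [e.left_inv (hAe hzA), e'.right_inv hz]
    · rintro ⟨y, ⟨hy, hyA⟩, rfl⟩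
      exact ⟨e'.map_source (hAe' hyA), by simpa [e'.left_inv (hAe' hyA)] using hyA⟩
  have hinj : Set.InjOn (e' ∘ e.symm) (e.target ∩ e.symm ⁻¹' A) := by
    rintro y ⟨hy, hyA⟩ z ⟨hz, hzA⟩ h
    exact e.symm.injOn hy hz (e'.injOn (hAe' hyA) (hAe' hzA) h)
  rw [himg, lintegral_image_eq_lintegral_abs_det_fderiv_mul volume
    (he.measurableSet_target_inter_preimage hA)
    (fun y hy => (he.hasFDerivWithinAt_transition he' hy.1 (hAe' hy.2)).mono
      Set.inter_subset_left) hinj]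
  refine setLIntegral_congr_fun (he.measurableSet_target_inter_preimage hA) fun y hy => ?_
  simp only [Function.comp_apply]
  rw [det_metricCoeff_transition g he' (hAe' hy.2), Real.sqrt_mul (sq_nonneg _),
    Real.sqrt_sq_eq_abs, ENNReal.ofReal_mul (abs_nonneg _)]

end Parametrization

section LocalBounds

variable {M : Type*} [TopologicalSpace M] [ChartedSpace (EuclideanHalfSpace 3) M]
  [IsManifold I3 ∞ M]

/-! ### Local bounds on the metric in the preferred charts -/

/-- With the fibres normed by `g`, the tangent bundle trivialization is locally bounded, and its
fibre maps are the differentials of the chart. The next lemma uses the inverse trivialization in the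
same way. -/
theorem eventually_norm_coordDeriv_le (g : Metric3 M) (p : M) :
    ∃ C : ℝ, 0 < C ∧ ∀ᶠ x in 𝓝 p, ∀ v : E3, metricForm g x v v ≤ 1 →
      ‖coordDeriv (extChartAt I3 p) x v‖ ≤ C := by
  have : IsManifold I3 1 M := IsManifold.of_le (n := ∞) (by simp)
  let _ : Bundle.RiemannianBundle (fun x : M => TangentSpace I3 x) :=
    ⟨g.toContinuousRiemannianMetric.toRiemannianMetric⟩
  obtain ⟨C, hC, h⟩ := eventually_norm_trivializationAt_lt E3
    (fun x : M => TangentSpace I3 x) p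
  refine ⟨C, hC, ?_⟩
  filter_upwards [h, chart_source_mem_nhds (EuclideanHalfSpace 3) p] with x hx hxs v hv
  rw [TangentBundle.continuousLinearMapAt_trivializationAt hxs] at hx
  have key : ∀ L : TangentSpace I3 x →L[ℝ] E3, ‖L‖ < C →
      ∀ w : TangentSpace I3 x, g.inner x w w ≤ 1 → ‖L w‖ ≤ C := by
    intro L hL w hw
    have h2 : ‖w‖ ^ 2 ≤ 1 := (real_inner_self_eq_norm_sq w).symm.trans_le hw
    have h3 : ‖w‖ ≤ 1 := by nlinarith [norm_nonneg w]
    refine (L.le_of_opNorm_le hL.le w).trans ?_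
    exact (mul_le_mul_of_nonneg_left h3 hC.le).trans_eq (mul_one C)
  exact key _ hx v hv

theorem eventually_abs_metricCoeff_le (g : Metric3 M) (p : M) :
    ∃ C : ℝ, 0 < C ∧ ∀ᶠ x in 𝓝 p, ∀ i j,
      |chartCoeff g p (extChartAt I3 p x) i j| ≤ C := by
  have : IsManifold I3 1 M := IsManifold.of_le (n := ∞) (by simp)
  let _ : Bundle.RiemannianBundle (fun x : M => TangentSpace I3 x) :=
    ⟨g.toContinuousRiemannianMetric.toRiemannianMetric⟩
  obtain ⟨C, hC, h⟩ := eventually_norm_symmL_trivializationAt_lt E3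
    (fun x : M => TangentSpace I3 x) p
  refine ⟨C * C, mul_pos hC hC, ?_⟩
  filter_upwards [h, chart_source_mem_nhds (EuclideanHalfSpace 3) p] with x hx hxs i j
  have hxs' : x ∈ (extChartAt I3 p).source := by rwa [extChartAt_source]
  rw [TangentBundle.symmL_trivializationAt hxs] at hx
  -- The trivialization is expressed by a derivative within `Set.range I3`; near a point of the
  -- target the two sets coincide.
  have hd : coordSymmDeriv (extChartAt I3 p) (extChartAt I3 p x) =
      mfderivWithin 𝓘(ℝ, E3) I3 (extChartAt I3 p).symm (Set.range I3) (extChartAt I3 p x) := by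
    have := (extChartAt I3 p).map_source hxs'
    exact mfderivWithin_congr_set (extChartAt_target_eventuallyEq_of_mem this)
  have key : ∀ L : E3 →L[ℝ] TangentSpace I3 x, ‖L‖ < C → ∀ v w : E3, ‖v‖ = 1 → ‖w‖ = 1 →
      |g.inner x (L v) (L w)| ≤ C * C := by
    intro L hL v w hv hw
    have h1 := L.le_of_opNorm_le hL.le v
    have h2 := L.le_of_opNorm_le hL.le w
    rw [hv, mul_one] at h1
    rw [hw, mul_one] at h2
    exact (abs_real_inner_le_norm (L v) (L w)).trans
      (mul_le_mul h1 h2 (norm_nonneg _) hC.le)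
  have hcoe : chartCoeff g p (extChartAt I3 p x) i j =
      metricForm g x (coordSymmDeriv (extChartAt I3 p) (extChartAt I3 p x) (stdVec i))
        (coordSymmDeriv (extChartAt I3 p) (extChartAt I3 p x) (stdVec j)) := by
    rw [chartCoeff, metricCoeff_apply, (extChartAt I3 p).left_inv hxs']
  rw [hcoe, hd]
  exact key _ hx _ _ (by simp) (by simp)

/-! ### Continuously differentiable functions -/

theorem contDiffOn_comp_extChartAt_symm {ψ : M → ℝ} (hψ : ContMDiff I3 𝓘(ℝ, ℝ) 1 ψ) (p : M) :
    ContDiffOn ℝ 1 (ψ ∘ (extChartAt I3 p).symm) (extChartAt I3 p).target :=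
  contMDiffOn_iff_contDiffOn.1
    (hψ.comp_contMDiffOn (isCoordinates_extChartAt p).contMDiffOn_symm)

theorem locLipschitz_of_contMDiff {ψ : M → ℝ} (hψ : ContMDiff I3 𝓘(ℝ, ℝ) 1 ψ) :
    LocLipschitz ψ := by
  intro p y hy
  have hn := nhdsWithin_extChartAt_target_eq_of_mem (I := I3) hy
  have h : ContDiffWithinAt ℝ 1 (ψ ∘ (extChartAt I3 p).symm) (Set.range I3) y :=
    (contDiffOn_comp_extChartAt_symm hψ p y hy).mono_of_mem_nhdsWithin
      (hn ▸ self_mem_nhdsWithin)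
  obtain ⟨K, t, ht, hK⟩ := h.exists_lipschitzOnWith I3.convex_range
  exact ⟨K, t, hn ▸ ht, hK⟩

/-- The coordinate differential of `ψ` is continuous, and `g`-unit vectors have locally bounded
coordinates. This makes the energy of a smooth cutoff finite. -/
theorem eventually_gradSq_le (g : Metric3 M) {ψ : M → ℝ} (hψ : ContMDiff I3 𝓘(ℝ, ℝ) 1 ψ)
    (p : M) : ∃ C : ℝ, ∀ᶠ x in 𝓝 p, gradSq g ψ x ≤ ENNReal.ofReal C := by
  obtain ⟨C, hC, hev⟩ := eventually_norm_coordDeriv_le g p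
  set e := extChartAt I3 p with he
  set f : E3 → ℝ := ψ ∘ e.symm with hf
  have hco := isCoordinates_extChartAt p
  have hsm := contDiffOn_comp_extChartAt_symm hψ p
  have hcont := hsm.continuousOn_fderivWithin hco.uniqueDiffOn_target le_rfl
  have hpt : e p ∈ e.target := mem_extChartAt_target p
  set B : ℝ := ‖fderivWithin ℝ f e.target (e p)‖ + 1 with hB
  have h1 : ∀ᶠ x in 𝓝 p, ‖fderivWithin ℝ f e.target (e x)‖ ≤ B := by
    have h2 : ContinuousOn (fun x => ‖fderivWithin ℝ f e.target (e x)‖) e.source :=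
      (hcont.comp (continuousOn_extChartAt p) e.mapsTo).norm
    have h3 := (h2.continuousAt (extChartAt_source_mem_nhds p)).eventually_lt
      (continuousAt_const (y := B)) (by simp [hB])
    exact h3.mono fun x hx => hx.le
  refine ⟨(B * C) ^ 2, ?_⟩
  filter_upwards [hev, h1, extChartAt_source_mem_nhds (I := I3) p] with x hx hxB hxs
  refine iSup₂_le fun v hv => ENNReal.ofReal_le_ofReal ?_
  have hd : differential ψ x v = fderivWithin ℝ f e.target (e x) (coordDeriv e x v) := by
    have h2 : HasMFDerivWithinAt I3 𝓘(ℝ, ℝ) (f ∘ e) e.source x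
        ((fderivWithin ℝ f e.target (e x)).comp (coordDeriv e x)) :=
      ((hsm.differentiableOn one_ne_zero _
        (e.map_source hxs)).hasFDerivWithinAt.hasMFDerivWithinAt).comp x
        (hco.hasMFDerivAt hxs).hasMFDerivWithinAt e.mapsTo
    have h3 := (h2.congr_mono (fun y hy => by simp [hf, e.left_inv hy])
      (by simp [hf, e.left_inv hxs]) subset_rfl : HasMFDerivWithinAt I3 𝓘(ℝ, ℝ) ψ e.source x _)
    have h4 := (h3.hasMFDerivAt (extChartAt_source_mem_nhds' hxs)).mfderiv
    rw [differential, h4]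
    rfl
  have hb : |differential ψ x v| ≤ B * C := by
    rw [hd]
    exact (ContinuousLinearMap.le_opNorm _ _).trans
      (mul_le_mul hxB (hx v hv) (norm_nonneg _) (by positivity))
  exact sq_le_sq.2 (hb.trans (le_abs_self _))

end LocalBounds

section Volume

variable {M : Type*} [TopologicalSpace M] [ChartedSpace (EuclideanHalfSpace 3) M]
  [IsManifold I3 ∞ M] [MeasurableSpace M] [BorelSpace M]

/-! ### The Riemannian volume measure -/

theorem coordVolume_inter_source (g : Metric3 M) {e : PartialEquiv M E3}
    (he : IsCoordinates e) {A : Set M} (hA : MeasurableSet A) :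
    coordVolume g e (A ∩ e.source) = coordVolume g e A := by
  rw [coordVolume_apply g he hA, coordVolume_apply g he (hA.inter he.isOpen_source.measurableSet)]
  congr 2
  ext y
  simp only [Set.mem_inter_iff, Set.mem_preimage]
  exact ⟨fun h => ⟨h.1, h.2.1⟩, fun h => ⟨h.1, h.2, e.map_target h.1⟩⟩

/-- The Riemannian measure in any coordinate system is dominated by the Riemannian volume. -/
theorem coordVolume_le_vol [SecondCountableTopology M] (g : Metric3 M) {e : PartialEquiv M E3}
    (he : IsCoordinates e) : coordVolume g e ≤ vol g := by
  obtain ⟨s, hs, hcov⟩ := TopologicalSpace.countable_cover_nhds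
    (fun p : M => extChartAt_source_mem_nhds (I := I3) p)
  rcases s.eq_empty_or_nonempty with rfl | hne
  · have : IsEmpty M := by
      rw [← Set.univ_eq_empty_iff, ← hcov]; simp
    exact Measure.le_iff.2 fun A _ => by simp [Set.eq_empty_of_isEmpty A]
  obtain ⟨t, rfl⟩ := hs.exists_eq_range hne
  -- Each piece lies in a single preferred chart, where the two coordinate measures agree; countable
  -- additivity reassembles them.
  set D : ℕ → Set M := disjointed fun n => (extChartAt I3 (t n)).source with hD
  have hDm : ∀ n, MeasurableSet (D n) := MeasurableSet.disjointed fun n =>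
    (isOpen_extChartAt_source (t n)).measurableSet
  have hDd : Pairwise (Function.onFun Disjoint D) := disjoint_disjointed _
  have hDu : ⋃ n, D n = Set.univ := by
    rw [hD, iUnion_disjointed, ← hcov, Set.biUnion_range]
  refine Measure.le_iff.2 fun A hA => ?_
  have hsplit : ∀ μ : Measure M, μ A = ∑' n, μ (A ∩ D n) := by
    intro μ
    rw [← measure_iUnion (fun i j hij => (hDd hij).mono Set.inter_subset_right
      Set.inter_subset_right) (fun n => hA.inter (hDm n)), ← Set.inter_iUnion, hDu, Set.inter_univ]
  rw [hsplit, hsplit (vol g)]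
  refine ENNReal.tsum_le_tsum fun n => ?_
  have hm := hA.inter (hDm n)
  rw [← coordVolume_inter_source g he hm,
    coordVolume_eq_of_subset g he (isCoordinates_extChartAt (t n))
      (hm.inter he.isOpen_source.measurableSet) Set.inter_subset_right
      (Set.inter_subset_left.trans (Set.inter_subset_right.trans (disjointed_subset _ n)))]
  calc coordVolume g (extChartAt I3 (t n)) (A ∩ D n ∩ e.source)
      ≤ vol g (A ∩ D n ∩ e.source) := le_iSup (fun p => chartVolume g p) (t n) _
    _ ≤ vol g (A ∩ D n) := measure_mono Set.inter_subset_left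

/-- On the domain of a coordinate system, the Riemannian volume is computed in coordinates. -/
theorem vol_le_coordVolume (g : Metric3 M) {e : PartialEquiv M E3}
    (he : IsCoordinates e) {A : Set M} (hA : MeasurableSet A) (hAe : A ⊆ e.source) :
    vol g A ≤ coordVolume g e A := by
  -- A supremum of measures is bounded by exhibiting one measure above them all. The added term is
  -- infinite on every set that meets `Aᶜ`, so only subsets of `A` need checking, and it vanishes on
  -- `A` itself.
  have hle : vol g ≤ coordVolume g e + ((⊤ : ℝ≥0∞) • Measure.count).restrict Aᶜ := by
    refine iSup_le fun p => Measure.le_iff.2 fun B hB => ?_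
    rw [Measure.add_apply, Measure.restrict_apply hB]
    by_cases hBA : B ⊆ A
    · refine le_add_right ?_
      have hp := isCoordinates_extChartAt p
      change coordVolume g (extChartAt I3 p) B ≤ _
      rw [← coordVolume_inter_source g hp hB,
        coordVolume_eq_of_subset g hp he (hB.inter hp.isOpen_source.measurableSet)
          Set.inter_subset_right (Set.inter_subset_left.trans (hBA.trans hAe))]
      exact measure_mono Set.inter_subset_left
    · obtain ⟨x, hx, hxA⟩ := Set.not_subset.1 hBA
      have : (B ∩ Aᶜ).Nonempty := ⟨x, hx, hxA⟩
      have h0 : Measure.count (B ∩ Aᶜ) ≠ 0 := by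
        rw [Ne, Measure.count_eq_zero_iff]
        exact this.ne_empty
      simp [ENNReal.top_mul h0]
  refine (hle A).trans ?_
  simp [Measure.restrict_apply hA]

theorem exists_nhds_vol_lt_top (g : Metric3 M) (p : M) : ∃ N ∈ 𝓝 p, vol g N < ⊤ := by
  obtain ⟨C, hC, hev⟩ := eventually_abs_metricCoeff_le g p
  have hball : extChartAt I3 p ⁻¹' Metric.ball (extChartAt I3 p p) 1 ∈ 𝓝 p :=
    (continuousAt_extChartAt p).preimage_mem_nhds (Metric.ball_mem_nhds _ one_pos)
  obtain ⟨N, hN, hNo, hpN⟩ := mem_nhds_iff.1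
    (inter_mem (inter_mem hev hball) (extChartAt_source_mem_nhds (I := I3) p))
  refine ⟨N, hNo.mem_nhds hpN, ?_⟩
  have hp := isCoordinates_extChartAt p
  refine (vol_le_coordVolume g hp hNo.measurableSet fun x hx => (hN hx).2).trans_lt ?_
  rw [coordVolume_apply g hp hNo.measurableSet]
  calc ∫⁻ y in (extChartAt I3 p).target ∩ (extChartAt I3 p).symm ⁻¹' N,
        ENNReal.ofReal (Real.sqrt (metricCoeff g (extChartAt I3 p).symm
          (extChartAt I3 p).target y).det)
      ≤ ∫⁻ y in (extChartAt I3 p).target ∩ (extChartAt I3 p).symm ⁻¹' N,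
        ENNReal.ofReal (Real.sqrt (6 * C ^ 3)) := by
        refine setLIntegral_mono' (hp.measurableSet_target_inter_preimage hNo.measurableSet)
          fun y hy => ENNReal.ofReal_le_ofReal (Real.sqrt_le_sqrt ?_)
        have h := (hN hy.2).1.1
        simp only [Set.mem_ofPred_eq, (extChartAt I3 p).right_inv hy.1] at h
        -- Leibniz formula: `3!` products of three entries, each of size at most `C`.
        have h2 := Matrix.det_le (A := chartCoeff g p y) (abv := AbsoluteValue.abs) (x := C) h
        refine (le_abs_self _).trans (h2.trans_eq ?_)
        simp [Nat.factorial]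
    _ ≤ ENNReal.ofReal (Real.sqrt (6 * C ^ 3)) *
          volume (Metric.ball (extChartAt I3 p p) 1) := by
        rw [setLIntegral_const]
        gcongr
        rintro y ⟨hy, hyN⟩
        have h := (hN hyN).1.2
        simpa only [Set.mem_preimage, (extChartAt I3 p).right_inv hy] using h
    _ < ⊤ := ENNReal.mul_lt_top ENNReal.ofReal_lt_top measure_ball_lt_top

theorem vol_lt_top_of_isCompact (g : Metric3 M) {K : Set M} (hK : IsCompact K) :
    vol g K < ⊤ :=
  hK.measure_lt_top_of_nhdsWithin fun p _ =>
    let ⟨N, hN, h⟩ := exists_nhds_vol_lt_top g p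
    ⟨N, mem_nhdsWithin_of_mem_nhds hN, h⟩

/-! ### Finiteness of the capacity of compact sets -/

/-- A smooth cutoff, `0` on `K` and `1` off a compact neighbourhood, has its gradient supported in a
compact set, where it is bounded and the volume is finite. -/
theorem ecapacity_lt_top [T2Space M] [SecondCountableTopology M] (g : Metric3 M) {K : Set M}
    (hK : IsCompact K) : ecapacity g K < ⊤ := by
  have : LocallyCompactSpace M := Manifold.locallyCompact_of_finiteDimensional I3
  obtain ⟨L, hL, hKL⟩ := exists_compact_superset hK
  obtain ⟨f, hf0, hf1, -⟩ := exists_contMDiffMap_zero_one_of_isClosed I3 (n := 1)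
    hK.isClosed isOpen_interior.isClosed_compl
    (Set.disjoint_compl_right_iff_subset.2 hKL)
  have hLc : Set.EqOn f 1 Lᶜ := fun x hx => hf1 fun h => hx (interior_subset h)
  have hadm : IsAdmissible K f :=
    { locLipschitz := locLipschitz_of_contMDiff f.contMDiff
      eq_zero := fun x hx => hf0 hx
      tendsto_one := tendsto_const_nhds.congr'
        (mem_of_superset hL.compl_mem_cocompact fun x hx => (hLc hx).symm) }
  refine (iInf₂_le (f : M → ℝ) hadm).trans_lt (ENNReal.mul_lt_top ENNReal.ofReal_lt_top ?_)
  rw [← lintegral_add_compl _ hL.measurableSet]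
  have h2 : ∫⁻ x in Lᶜ, gradSq g f x ∂(vol g) = 0 := by
    rw [setLIntegral_congr_fun (g := fun _ => 0) hL.measurableSet.compl, lintegral_zero]
    intro x hx
    have h3 : (f : M → ℝ) =ᶠ[𝓝 x] fun _ => 1 :=
      mem_of_superset (hL.isClosed.isOpen_compl.mem_nhds hx) hLc
    simp only [gradSq, differential, h3.mfderiv_eq, mfderiv_const]
    simp
    exact fun _ _ => rfl
  rw [h2, add_zero]
  refine hL.induction_on (p := fun s => ∫⁻ x in s, gradSq g f x ∂(vol g) < ⊤) (by simp)
    (fun s t hst ht => (lintegral_mono_set hst).trans_lt ht)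
    (fun s t hs ht => (lintegral_union_le _ _ _).trans_lt (ENNReal.add_lt_top.2 ⟨hs, ht⟩)) ?_
  intro p _
  obtain ⟨C, hC⟩ := eventually_gradSq_le g f.contMDiff p
  obtain ⟨N, hN, hNv⟩ := exists_nhds_vol_lt_top g p
  obtain ⟨U, hU, hUo, hpU⟩ := mem_nhds_iff.1 (inter_mem hC hN)
  refine ⟨U, mem_nhdsWithin_of_mem_nhds (hUo.mem_nhds hpU), ?_⟩
  calc ∫⁻ x in U, gradSq g f x ∂(vol g) ≤ ∫⁻ x in U, ENNReal.ofReal C ∂(vol g) :=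
        setLIntegral_mono' hUo.measurableSet fun x hx => (hU hx).1
    _ = ENNReal.ofReal C * vol g U := setLIntegral_const _ _
    _ < ⊤ := ENNReal.mul_lt_top ENNReal.ofReal_lt_top
        ((measure_mono fun x hx => (hU hx).2).trans_lt hNv)

end Volume

section LowerBound

variable {M : Type*} [TopologicalSpace M] [ChartedSpace (EuclideanHalfSpace 3) M]
  [IsManifold I3 ∞ M]

/-! ### The metric near infinity -/

/-- The coefficient matrix tends to the identity. The bound `1/4` makes the volume density at least
`1/2`; the bound `2` controls the length of coordinate vectors. -/
theorem IsAFChart.exists_radius {g : Metric3 M} {Φ : OpenPartialHomeomorph M E3} {τ : ℝ}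
    (h : IsAFChart g Φ τ) (hτ : 1 / 2 < τ) :
    ∃ R : ℝ, 0 < R ∧ ∀ y : E3, R < ‖y‖ → y ∈ Φ.target ∧
      1 / 4 ≤ (metricCoeff g Φ.symm Φ.target y).det ∧
      ∀ i j, |metricCoeff g Φ.symm Φ.target y i j| ≤ 2 := by
  have hdecay : Tendsto (fun y : E3 => ‖y‖ ^ (-τ)) (Bornology.cobounded E3) (𝓝 0) :=
    (tendsto_rpow_neg_atTop (by linarith)).comp tendsto_norm_cobounded_atTop
  have hlim : Tendsto (metricCoeff g Φ.symm Φ.target) (Bornology.cobounded E3) (𝓝 1) := by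
    refine tendsto_pi_nhds.2 fun i => tendsto_pi_nhds.2 fun j => ?_
    have := ((h.decay i j).trans_tendsto hdecay).add_const ((1 : Matrix (Fin 3) (Fin 3) ℝ) i j)
    simpa using this
  have h1 : ∀ᶠ y in Bornology.cobounded E3,
      1 / 4 ≤ (metricCoeff g Φ.symm Φ.target y).det := by
    have hd : Tendsto (fun y => (metricCoeff g Φ.symm Φ.target y).det)
        (Bornology.cobounded E3) (𝓝 1) := by
      have hc : Continuous fun A : Matrix (Fin 3) (Fin 3) ℝ => A.det := continuous_id.matrix_det
      have := (hc.tendsto 1).comp hlim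
      rwa [Matrix.det_one] at this
    exact (hd.eventually_const_lt (by norm_num : (1 / 4 : ℝ) < 1)).mono fun y hy => hy.le
  have h2 : ∀ᶠ y in Bornology.cobounded E3, ∀ i j,
      |metricCoeff g Φ.symm Φ.target y i j| ≤ 2 := by
    refine eventually_all.2 fun i => eventually_all.2 fun j => ?_
    have hij := (tendsto_pi_nhds.1 (tendsto_pi_nhds.1 hlim i) j).abs
    refine (hij.eventually_lt_const (u := 2) ?_).mono fun y hy => hy.le
    rw [Matrix.one_apply]
    split_ifs <;> norm_num
  have h3 : ∀ᶠ y in Bornology.cobounded E3, y ∈ Φ.target := by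
    obtain ⟨c, R, -, hR⟩ := h.target_eq
    rw [hR]
    exact (Metric.hasBasis_cobounded_compl_closedBall c).mem_of_mem trivial
  obtain ⟨R, -, hR⟩ := hasBasis_cobounded_norm.eventually_iff.1 (h3.and (h1.and h2))
  exact ⟨max R 1, by positivity, fun y hy => hR ((le_max_left _ _).trans hy.le)⟩

theorem abs_bilinForm_self_le {B : LinearMap.BilinForm ℝ E3} {C : ℝ}
    (hB : ∀ i j, |B (stdVec i) (stdVec j)| ≤ C) {v : E3} (hv : ‖v‖ ≤ 1) :
    |B v v| ≤ 9 * C := by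
  have hC : 0 ≤ C := (abs_nonneg _).trans (hB 0 0)
  have hv' : ∀ i, |v i| ≤ 1 := fun i => (PiLp.norm_apply_le v i).trans hv
  have hexp : B v v = ∑ i, ∑ j, v i * (v j * B (stdVec i) (stdVec j)) := by
    have h0 : v = ∑ i, v i • stdVec i := by
      ext k
      simp [Finset.sum_apply, Pi.single_apply]
    conv_lhs => rw [h0]
    simp only [map_sum, map_smul, LinearMap.sum_apply, LinearMap.smul_apply, smul_eq_mul,
      Finset.mul_sum]
    rw [Finset.sum_comm]
    exact Finset.sum_congr rfl fun i _ => Finset.sum_congr rfl fun j _ => by ring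
  rw [hexp]
  calc |∑ i, ∑ j, v i * (v j * B (stdVec i) (stdVec j))|
      ≤ ∑ i : Fin 3, ∑ j : Fin 3, C := by
        refine (Finset.abs_sum_le_sum_abs _ _).trans (Finset.sum_le_sum fun i _ =>
          (Finset.abs_sum_le_sum_abs _ _).trans (Finset.sum_le_sum fun j _ => ?_))
        rw [abs_mul, abs_mul, ← mul_assoc]
        have : |v i| * |v j| ≤ 1 := mul_le_one₀ (hv' i) (abs_nonneg _) (hv' j)
        calc |v i| * |v j| * |B (stdVec i) (stdVec j)| ≤ 1 * C :=
              mul_le_mul this (hB i j) (abs_nonneg _) zero_le_one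
          _ = C := one_mul C
    _ = 9 * C := by simp; ring

/-- Where the metric coefficients are bounded, the gradient in `M` controls the gradient in the
coordinates. -/
theorem ofReal_sq_fderiv_le_gradSq {g : Metric3 M} {Φ : OpenPartialHomeomorph M E3}
    (hΦ : IsCoordinates Φ.toPartialEquiv) {y : E3} (hy : y ∈ Φ.target)
    (hG : ∀ i j, |metricCoeff g Φ.symm Φ.target y i j| ≤ 2) (ψ : M → ℝ) {w : E3}
    (hw : ‖w‖ ≤ 1) :
    ENNReal.ofReal (1 / 25 * fderiv ℝ (ψ ∘ Φ.symm) y w ^ 2) ≤ gradSq g ψ (Φ.symm y) := by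
  -- Without differentiability `fderiv` is zero by convention and the left side vanishes.
  by_cases hd : DifferentiableAt ℝ (ψ ∘ Φ.symm) y
  swap
  · simp [fderiv_zero_of_not_differentiableAt hd]
  set e := Φ.toPartialEquiv with he
  set x : M := Φ.symm y with hx
  have hxs : x ∈ e.source := Φ.map_target hy
  have hxy : e x = y := Φ.right_inv hy
  have hdiff : ∀ v : E3, differential ψ x v = fderiv ℝ (ψ ∘ Φ.symm) y (coordDeriv e x v) := by
    have h1 : HasMFDerivAt I3 𝓘(ℝ, ℝ) ((ψ ∘ Φ.symm) ∘ e) x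
        ((fderiv ℝ (ψ ∘ Φ.symm) y).comp (coordDeriv e x)) :=
      HasMFDerivAt.comp x (by rw [hxy]; exact hd.hasFDerivAt.hasMFDerivAt) (hΦ.hasMFDerivAt hxs)
    have h2 : ψ =ᶠ[𝓝 x] (ψ ∘ Φ.symm) ∘ e :=
      mem_of_superset (hΦ.isOpen_source.mem_nhds hxs) fun z hz =>
        congrArg ψ (Φ.left_inv hz).symm
    intro v
    rw [differential, (h1.congr_of_eventuallyEq h2).mfderiv]
    rfl
  -- The nine coefficients of size at most `2` give `g(w, w) ≤ 18`, so scaling by `1/5` brings the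
  -- vector into the unit ball of `g`.
  set v : E3 := coordSymmDeriv e y ((1 / 5 : ℝ) • w) with hv
  have hgv : g.inner x v v ≤ 1 := by
    have h1 : ∀ i j, |coordForm g e y (stdVec i) (stdVec j)| ≤ 2 := hG
    have h2 := abs_bilinForm_self_le h1 hw
    have h3 : g.inner x v v = (1 / 25) * coordForm g e y w w := by
      change metricForm g x v v = (1 / 25) * metricForm g x (coordSymmDeriv e y w)
        (coordSymmDeriv e y w)
      simp only [hv, map_smul, smul_apply, smul_eq_mul]
      ring
    rw [h3]
    linarith [le_abs_self (coordForm g e y w w)]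
  have hval : differential ψ x v = 1 / 5 * fderiv ℝ (ψ ∘ Φ.symm) y w := by
    have h1 : coordDeriv e x v = (1 / 5 : ℝ) • w := by
      have := congrArg (fun L => L ((1 / 5 : ℝ) • w)) (hΦ.coordDeriv_comp hxs)
      rwa [hxy] at this
    rw [hdiff, h1, map_smul, smul_eq_mul]
  refine le_trans (ENNReal.ofReal_le_ofReal ?_) (le_iSup₂ (f := fun (v : TangentSpace I3 x)
    (_ : g.inner x v v ≤ 1) => ENNReal.ofReal ((differential ψ x v) ^ 2)) v hgv)
  rw [hval]
  exact le_of_eq (by ring)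

/-- In coordinates, a locally Lipschitz function is locally Lipschitz. -/
theorem LocLipschitz.locallyLipschitzOn_comp_symm {ψ : M → ℝ} (hψ : LocLipschitz ψ)
    {Φ : OpenPartialHomeomorph M E3} (hΦ : IsCoordinates Φ.toPartialEquiv) :
    LocallyLipschitzOn Φ.target (ψ ∘ Φ.symm) := by
  intro y hy
  set p : M := Φ.symm y with hp
  set e := extChartAt I3 p with he
  have hcont : ContinuousAt Φ.symm y := Φ.symm.continuousAt hy
  have hsrc : ∀ᶠ z in 𝓝 y, Φ.symm z ∈ e.source :=
    hcont.eventually_mem (extChartAt_source_mem_nhds p)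
  have hT : ContDiffAt ℝ 1 (e ∘ Φ.symm) y := by
    rw [← contMDiffAt_iff_contDiffAt]
    exact ((isCoordinates_extChartAt p).contMDiffOn.contMDiffAt
      (extChartAt_source_mem_nhds p)).comp y
        (hΦ.contMDiffOn_symm.contMDiffAt (Φ.open_target.mem_nhds hy))
  obtain ⟨K₁, t₁, ht₁, hK₁⟩ := hT.exists_lipschitzOnWith
  obtain ⟨K₂, t₂, ht₂, hK₂⟩ := hψ p (mem_extChartAt_target p)
  have hTt : ∀ᶠ z in 𝓝 y, (e ∘ Φ.symm) z ∈ t₂ := by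
    have : Tendsto (e ∘ Φ.symm) (𝓝 y) (𝓝[e.target] (e p)) :=
      tendsto_nhdsWithin_iff.2 ⟨hT.continuousAt, hsrc.mono fun z hz => e.map_source hz⟩
    exact this ht₂
  refine ⟨K₂ * K₁, _, mem_nhdsWithin_of_mem_nhds (inter_mem (inter_mem ht₁ hTt) hsrc), ?_⟩
  have h := hK₂.comp (hK₁.mono (s := t₁ ∩ {z | (e ∘ Φ.symm) z ∈ t₂} ∩ {z | Φ.symm z ∈ e.source})
    fun z hz => hz.1.1) fun z hz => hz.1.2
  have hu : ∀ z, Φ.symm z ∈ e.source →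
      ((ψ ∘ e.symm) ∘ e ∘ Φ.symm) z = (ψ ∘ Φ.symm) z := fun z hz => congrArg ψ (e.left_inv hz)
  intro a ha b hb
  rw [← hu a ha.2, ← hu b hb.2]
  exact h ha hb

variable [MeasurableSpace M] [BorelSpace M]

/-- Where `det g_ij ≥ 1 / 4`, integrals for the Riemannian volume are bounded below by half the
Lebesgue integral in the coordinates. -/
theorem half_lintegral_le_lintegral_vol [SecondCountableTopology M] (g : Metric3 M)
    {Φ : OpenPartialHomeomorph M E3} (hΦ : IsCoordinates Φ.toPartialEquiv) {U : Set E3}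
    (hU : MeasurableSet U) (hUt : U ⊆ Φ.target)
    (hG : ∀ y ∈ U, 1 / 4 ≤ (metricCoeff g Φ.symm Φ.target y).det)
    {h : E3 → ℝ≥0∞} (hh : Measurable h) :
    ENNReal.ofReal (1 / 2) * ∫⁻ y in U, h y ≤
      ∫⁻ x, Φ.source.indicator (h ∘ Φ) x ∂(vol g) := by
  have hsm := Φ.open_source.measurableSet
  have hF : ∀ μ : Measure M, AEMeasurable (Φ.source.indicator (h ∘ Φ)) μ := fun μ =>
    (aemeasurable_indicator_iff hsm).2
      (hh.comp_aemeasurable (hΦ.contMDiffOn.continuousOn.aemeasurable hsm))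
  refine le_trans ?_ (lintegral_mono' (coordVolume_le_vol g hΦ) le_rfl)
  have hm : AEMeasurable Φ.symm ((volume : Measure E3).restrict Φ.target) :=
    hΦ.contMDiffOn_symm.continuousOn.aemeasurable hΦ.measurableSet_target
  rw [coordVolume]
  erw [lintegral_map' (hF _) (hm.mono_ac (withDensity_absolutelyContinuous _ _))]
  -- Comparing measures rather than integrands avoids any measurability question about the density
  -- `√det`.
  have hle : ENNReal.ofReal (1 / 2) • (volume : Measure E3).restrict U ≤
      ((volume : Measure E3).restrict Φ.target).withDensity
        (fun y => ENNReal.ofReal (Real.sqrt (metricCoeff g Φ.symm Φ.target y).det)) := by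
    refine Measure.le_iff.2 fun B hB => ?_
    rw [withDensity_apply _ hB, Measure.smul_apply, smul_eq_mul, ← setLIntegral_one,
      ← lintegral_const_mul' _ _ ENNReal.ofReal_ne_top, Measure.restrict_restrict hB,
      Measure.restrict_restrict hB]
    refine le_trans ?_ (lintegral_mono' (Measure.restrict_mono
      (Set.inter_subset_inter_right B hUt) le_rfl) le_rfl)
    refine setLIntegral_mono' (hB.inter hU) fun y hy => ?_
    rw [mul_one]
    refine ENNReal.ofReal_le_ofReal (Real.le_sqrt_of_sq_le ?_)
    exact le_trans (by norm_num) (hG y hy.2)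
  refine le_trans ?_ (lintegral_mono' hle le_rfl)
  rw [lintegral_smul_measure, smul_eq_mul]
  refine mul_le_mul_right (setLIntegral_mono' hU fun y hy => ?_) _
  rw [Set.indicator_of_mem (Φ.map_target (hUt hy))]
  simp [Φ.right_inv (hUt hy)]

/-! ### The end of an asymptotically flat manifold -/

/-- The map `y ↦ (1 + R/‖y‖) y` adds `R` to the norm and carries the connected punctured space onto
this set. -/
theorem isPreconnected_setOf_lt_norm {R : ℝ} (hR : 0 ≤ R) :
    IsPreconnected {y : E3 | R < ‖y‖} := by
  have hrank : 1 < Module.rank ℝ E3 := by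
    rw [← Module.finrank_eq_rank]; simp
  have h := (isConnected_compl_singleton_of_one_lt_rank hrank (0 : E3)).isPreconnected
  have hcont : ContinuousOn (fun y : E3 => (1 + R * ‖y‖⁻¹) • y) {0}ᶜ := by
    refine ContinuousOn.smul (continuousOn_const.add (continuousOn_const.mul
      (continuous_norm.continuousOn.inv₀ fun y hy => norm_ne_zero_iff.2 hy))) continuousOn_id
  convert h.image _ hcont using 1
  ext y
  constructor
  · intro hy
    have hy : R < ‖y‖ := hy
    have hn : 0 < ‖y‖ := hR.trans_lt hy
    have hs : 0 < ‖y‖ - R := sub_pos.2 hy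
    refine ⟨((‖y‖ - R) / ‖y‖) • y, ?_, ?_⟩
    · simp only [Set.mem_compl_iff, Set.mem_singleton_iff, smul_eq_zero, not_or]
      exact ⟨(div_pos hs hn).ne', norm_pos_iff.1 hn⟩
    · have : ‖((‖y‖ - R) / ‖y‖) • y‖ = ‖y‖ - R := by
        rw [norm_smul, Real.norm_of_nonneg (div_pos hs hn).le]
        field_simp
      simp only [this, smul_smul]
      rw [show (1 + R * (‖y‖ - R)⁻¹) * ((‖y‖ - R) / ‖y‖) = 1 by field_simp; ring, one_smul]
  · rintro ⟨z, hz, rfl⟩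
    have hn : 0 < ‖z‖ := norm_pos_iff.2 hz
    simp only [Set.mem_ofPred_eq, norm_smul]
    rw [Real.norm_of_nonneg (by positivity), add_mul, mul_assoc, inv_mul_cancel₀ hn.ne']
    linarith

theorem volume_setOf_lt_norm (R : ℝ) : (volume : Measure E3) {y : E3 | R < ‖y‖} = ⊤ := by
  have h1 : (volume : Measure E3) Set.univ = ⊤ := measure_univ_of_isAddLeftInvariant _
  have h2 : (Set.univ : Set E3) ⊆ Metric.closedBall 0 R ∪ {y : E3 | R < ‖y‖} := fun y _ => by
    simpa using le_or_gt ‖y‖ R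
  have h3 := (measure_mono h2).trans (measure_union_le (μ := (volume : Measure E3)) _ _)
  rw [h1, top_le_iff, ENNReal.add_eq_top] at h3
  exact h3.resolve_left measure_closedBall_lt_top.ne

/-- A compact subset of an asymptotically flat manifold is bounded in the asymptotically flat
coordinates. -/
theorem exists_forall_symm_notMem [T2Space M] [SecondCountableTopology M] (g : Metric3 M)
    {Φ : OpenPartialHomeomorph M E3} (hΦ : IsCoordinates Φ.toPartialEquiv)
    (hc : IsCompact Φ.sourceᶜ) {R₀ : ℝ} (hR₀ : 0 < R₀)
    (hR : ∀ y : E3, R₀ < ‖y‖ → y ∈ Φ.target ∧ 1 / 4 ≤ (metricCoeff g Φ.symm Φ.target y).det)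
    {C : Set M} (hC : IsCompact C) : ∃ R : ℝ, R₀ ≤ R ∧ ∀ y : E3, R < ‖y‖ → Φ.symm y ∉ C := by
  have : LocallyCompactSpace M := Manifold.locallyCompact_of_finiteDimensional I3
  -- The interior of `L` contains both `C` and the complement of the chart, so the frontier of `L`
  -- is a compact subset of the chart domain, hence bounded in coordinates.
  obtain ⟨L, hL, hCL⟩ := exists_compact_superset (hC.union hc)
  have hfr : IsCompact (frontier L) := hL.of_isClosed_subset isClosed_frontier
    hL.isClosed.frontier_subset
  have hfrs : frontier L ⊆ Φ.source := fun x hx => by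
    by_contra hxs
    exact hx.2 (hCL (Or.inr hxs))
  obtain ⟨S, hS⟩ := (hfr.image_of_continuousOn (Φ.continuousOn.mono hfrs)).isBounded.exists_norm_le
  set R := max R₀ S with hRdef
  have hR0 : R₀ ≤ R := le_max_left _ _
  set V := {y : E3 | R < ‖y‖} with hV
  have hVt : V ⊆ Φ.target := fun y hy => (hR y (hR0.trans_lt hy)).1
  have hpre : IsPreconnected (Φ.symm '' V) :=
    (isPreconnected_setOf_lt_norm (hR₀.le.trans hR0)).image _ (Φ.symm.continuousOn.mono hVt)
  have hsub : Φ.symm '' V ⊆ interior L ∪ Lᶜ := by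
    rintro _ ⟨y, hy, rfl⟩
    by_contra hn
    rw [Set.mem_union, not_or, Set.notMem_compl_iff] at hn
    have hmem : Φ.symm y ∈ frontier L := ⟨subset_closure hn.2, hn.1⟩
    have := hS _ (Set.mem_image_of_mem Φ hmem)
    rw [Φ.right_inv (hVt hy)] at this
    exact absurd (show R < ‖y‖ from hy) (not_lt.2 (this.trans (le_max_right _ _)))
  refine ⟨R, hR0, fun y hy hyC => ?_⟩
  -- Beyond that bound the connected end misses the frontier, so it lies wholly inside or wholly
  -- outside `L`. Inside is impossible: the end has infinite volume and `L` finite volume. This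
  -- excludes an end that closes up at a point of `M`.
  rcases hpre.subset_or_subset isOpen_interior hL.isClosed.isOpen_compl
    (Set.disjoint_compl_right_iff_subset.2 interior_subset) hsub with h | h
  · have hm : MeasurableSet V := measurableSet_lt measurable_const measurable_norm
    have hlow := half_lintegral_le_lintegral_vol g hΦ hm hVt
      (fun z hz => (hR z (hR0.trans_lt hz)).2) (h := V.indicator 1)
      (measurable_one.indicator hm)
    have hup : ∫⁻ x, Φ.source.indicator (V.indicator 1 ∘ Φ) x ∂(vol g) ≤ vol g L := by
      rw [← lintegral_indicator_one hL.measurableSet]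
      refine lintegral_mono fun x => ?_
      by_cases hx : x ∈ Φ.source
      · by_cases hxV : Φ x ∈ V
        · have : x ∈ L := by
            rw [← Φ.left_inv hx]
            exact interior_subset (h (Set.mem_image_of_mem _ hxV))
          rw [Set.indicator_of_mem hx, Set.indicator_of_mem this, Function.comp_apply,
            Set.indicator_of_mem hxV]
          rfl
        · rw [Set.indicator_of_mem hx, Function.comp_apply, Set.indicator_of_notMem hxV]
          exact zero_le
      · rw [Set.indicator_of_notMem hx]
        exact zero_le
    have htop : ∫⁻ z in V, (V.indicator 1 : E3 → ℝ≥0∞) z = ⊤ := by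
      rw [lintegral_indicator_one hm, Measure.restrict_apply_self, volume_setOf_lt_norm]
    rw [htop, ENNReal.mul_top (by simp)] at hlow
    exact absurd (vol_lt_top_of_isCompact g hL) (not_lt.2 (hlow.trans hup))
  · exact h (Set.mem_image_of_mem _ hy) (interior_subset (hCL (Or.inl hyC)))

/-! ### Growth of the capacity -/

/-- The capacity of a set which contains a large coordinate sphere is bounded below by a multiple
of the radius. -/
theorem exists_le_ecapacity [T2Space M] [SecondCountableTopology M] {g : Metric3 M}
    {Φ : OpenPartialHomeomorph M E3} {τ : ℝ} (h : IsAFChart g Φ τ) (hτ : 1 / 2 < τ) :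
    ∃ c R₀ : ℝ, 0 < c ∧ 0 < R₀ ∧ {y : E3 | R₀ < ‖y‖} ⊆ Φ.target ∧
      ∀ R, R₀ < R → ∀ K : Set M, Φ.symm '' Metric.sphere 0 R ⊆ K →
        ENNReal.ofReal (c * R) ≤ ecapacity g K := by
  have hΦ := h.isCoordinates
  obtain ⟨R₀, hR₀, hfar⟩ := h.exists_radius hτ
  set σ : ℝ≥0∞ := (volume : Measure E3).toSphere Set.univ with hσ
  have hσ0 : σ ≠ 0 := by
    rw [hσ, Ne, Measure.measure_univ_eq_zero]
    exact Measure.toSphere_ne_zero _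
  have hσt : σ ≠ ⊤ := measure_ne_top _ _
  have hπ := Real.pi_pos
  -- The factors are the normalization of the capacity, the volume density, the gradient comparison,
  -- and the radial energy `R/4` times the area `σ` of the unit sphere.
  refine ⟨1 / (4 * Real.pi) * (1 / 2 * (1 / 25 * (1 / 4 * σ.toReal))), R₀,
    by have := ENNReal.toReal_pos hσ0 hσt; positivity, hR₀, fun y hy => (hfar y hy).1, ?_⟩
  intro R hR K hK
  refine le_iInf₂ fun ψ hψ => ?_
  set u : E3 → ℝ := ψ ∘ Φ.symm with hu
  have hlip : LocallyLipschitzOn {y : E3 | R₀ < ‖y‖} u :=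
    (hψ.locLipschitz.locallyLipschitzOn_comp_symm hΦ).mono fun y hy => (hfar y hy).1
  have hu0 : ∀ y, ‖y‖ = R → u y = 0 := fun y hy =>
    hψ.eq_zero _ (hK (Set.mem_image_of_mem _ (by simpa using hy)))
  obtain ⟨S, hS⟩ : ∃ S, ∀ y, S ≤ ‖y‖ → 1 / 2 ≤ u y := by
    have hev := hψ.tendsto_one.eventually_const_lt (by norm_num : (1 / 2 : ℝ) < 1)
    obtain ⟨C, hC, hCψ⟩ := mem_cocompact.1 hev
    obtain ⟨S, -, hS⟩ := exists_forall_symm_notMem g hΦ h.isCompact_compl hR₀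
      (fun y hy => ⟨(hfar y hy).1, (hfar y hy).2.1⟩) hC
    exact ⟨S + 1, fun y hy => le_of_lt (hCψ (hS y (by linarith)))⟩
  have hkey := le_lintegral_sq_radial_fderiv hR₀ hR hlip hu0 hS
  set U : Set E3 := {y : E3 | R < ‖y‖} with hU
  have hUm : MeasurableSet U := measurableSet_lt measurable_const measurable_norm
  have hUR : ∀ y ∈ U, R₀ < ‖y‖ := fun y hy => hR.trans hy
  set k : E3 → ℝ≥0∞ := fun y => ENNReal.ofReal (1 / 25 * fderiv ℝ u y (‖y‖⁻¹ • y) ^ 2) with hk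
  have hkm : Measurable k := by
    have h3 : Measurable fun y : E3 => (fderiv ℝ u y, ‖y‖⁻¹ • y) :=
      (measurable_fderiv ℝ u).prodMk (by fun_prop)
    have h4 : Continuous fun p : (E3 →L[ℝ] ℝ) × E3 => p.1 p.2 := by fun_prop
    exact (((h4.measurable.comp h3).pow_const 2).const_mul _).ennreal_ofReal
  have hvol := half_lintegral_le_lintegral_vol g hΦ hUm (fun y hy => (hfar y (hUR y hy)).1)
    (fun y hy => (hfar y (hUR y hy)).2.1) (hkm.indicator hUm)
  have hgrad : ∀ x, Φ.source.indicator (U.indicator k ∘ Φ) x ≤ gradSq g ψ x := by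
    intro x
    by_cases hx : x ∈ Φ.source
    · rw [Set.indicator_of_mem hx, Function.comp_apply]
      by_cases hxU : Φ x ∈ U
      · rw [Set.indicator_of_mem hxU]
        have hn := hfar _ (hUR _ hxU)
        have h1 := ofReal_sq_fderiv_le_gradSq hΦ hn.1 hn.2.2 ψ (w := ‖Φ x‖⁻¹ • Φ x) (by
          have := hR₀.trans (hUR _ hxU)
          rw [norm_smul, norm_inv, norm_norm, inv_mul_cancel₀ this.ne'])
        rwa [Φ.left_inv hx] at h1
      · rw [Set.indicator_of_notMem hxU]
        exact zero_le
    · rw [Set.indicator_of_notMem hx]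
      exact zero_le
  have hk2 : ∫⁻ y in U, U.indicator k y =
      ENNReal.ofReal (1 / 25) * ∫⁻ y in U, ENNReal.ofReal (fderiv ℝ u y (‖y‖⁻¹ • y) ^ 2) := by
    rw [← lintegral_const_mul' _ _ ENNReal.ofReal_ne_top]
    refine setLIntegral_congr_fun hUm fun y hy => ?_
    rw [Set.indicator_of_mem hy]
    exact ENNReal.ofReal_mul (by norm_num)
  calc ENNReal.ofReal (1 / (4 * Real.pi) * (1 / 2 * (1 / 25 * (1 / 4 * σ.toReal))) * R)
      = ENNReal.ofReal (1 / (4 * Real.pi)) * (ENNReal.ofReal (1 / 2) *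
          (ENNReal.ofReal (1 / 25) * (ENNReal.ofReal (R / 4) * σ))) := by
        conv_rhs => rw [← ENNReal.ofReal_toReal hσt]
        rw [← ENNReal.ofReal_mul (by linarith), ← ENNReal.ofReal_mul (by norm_num),
          ← ENNReal.ofReal_mul (by norm_num), ← ENNReal.ofReal_mul (by positivity)]
        congr 1
        ring
    _ ≤ ENNReal.ofReal (1 / (4 * Real.pi)) * ∫⁻ x, gradSq g ψ x ∂(vol g) := by
        refine mul_le_mul_right (le_trans ?_ (hvol.trans (lintegral_mono hgrad))) _
        rw [hk2]
        exact mul_le_mul_right (mul_le_mul_right hkey _) _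

theorem tendsto_capacity_atTop [T2Space M] [SecondCountableTopology M] {g : Metric3 M}
    (hg : IsAsymptoticallyFlat g) (K : CompactExhaustion M) :
    Tendsto (fun j => capacity g (K j)) atTop atTop := by
  obtain ⟨Φ, τ, hτ, hΦ⟩ := hg.exists_chart
  obtain ⟨c, R₀, hc, -, hsub, hcap⟩ := exists_le_ecapacity hΦ hτ
  refine tendsto_atTop.2 fun b => ?_
  -- Large enough for the sphere to lie in the end and for `c * R` to reach `b`.
  set R := max (R₀ + 1) (b / c) with hR
  have hRR : R₀ < R := (lt_add_one R₀).trans_le (le_max_left _ _)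
  have hb : b ≤ c * R := by
    rw [← div_le_iff₀' hc]
    exact le_max_right _ _
  have hcomp : IsCompact (Φ.symm '' Metric.sphere 0 R) :=
    (isCompact_sphere 0 R).image_of_continuousOn (Φ.symm.continuousOn.mono fun y hy =>
      hsub (by simpa [mem_sphere_zero_iff_norm.1 hy] using hRR))
  obtain ⟨n, hn⟩ := K.exists_superset_of_isCompact hcomp
  filter_upwards [eventually_ge_atTop n] with j hj
  exact hb.trans ((ENNReal.ofReal_le_iff_le_toReal (ecapacity_lt_top g (K.isCompact j)).ne).1
    (hcap R hRR _ (hn.trans (K.subset hj))))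

end LowerBound

end AFMass

end

theorem mainTheorem9 {M : Type*} [TopologicalSpace M] [T2Space M] [SecondCountableTopology M]
    [MeasurableSpace M] [BorelSpace M]
    [ChartedSpace (EuclideanHalfSpace 3) M] [IsManifold AFMass.I3 ∞ M]
    (g : AFMass.Metric3 M) (hg : AFMass.IsAsymptoticallyFlat g) :
    AFMass.isocapacitaryMass g =
      ⨆ K : CompactExhaustion M, Filter.limsup (fun j : ℕ =>
        ((AFMass.volumeRadius g (K j) - AFMass.capacity g (K j) : ℝ) : EReal)) Filter.atTop :=
  iSup_congr fun K => AFMass.limsup_deficit_eq (fun _ => measureReal_nonneg)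
    (AFMass.tendsto_capacity_atTop hg K)
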